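/- \textbf{Conventions.} A model category is a category with three classes of morphisms (weak equivalences, fibrations, cofibrations), with all small limits and colimits, satisfying the two-out-of-three, retract and lifting axioms, and admitting functorial (cofibration, trivial fibration) and (trivial cofibration, fibration) factorizations. $\gamma_{\mathtt C}:\mathtt C\to \mathrm{Ho}(\mathtt C)$ denotes the strict localization of a model category $\mathtt C$ at its weak equivalences; the objects of $\mathrm{Ho}(\mathtt C)$ are those of $\mathtt C$. We write $A\approx B$ if $A$ and $B$ are related by a finite zigzag of weak equivalences. A \emph{fibrant replacement} of $X\in\mathtt C$ is a weak equivalence $f_X:X\to FX$ with $FX$ fibrant; a \emph{fibrant C-replacement} $\tilde f_X:X\to\tilde FX$ is one for which $\tilde f_X$ is moreover a cofibration (for instance one that is $\mathrm{id}_X$ when $X$ is fibrant); a \emph{fibrant C-replacement functor} is an endofunctor $R$ with a natural transformation $r:\mathrm{id}\Rightarrow R$ such that every $r_X:X\to RX$ is a fibrant C-replacement (for instance one given by a functorial factorization of the maps $X\to *$). For fibrant replacements $a:X\to A$ and $b:X\to B$, a \emph{lifting} is a morphism $\ell:A\to B$ with $\ell\circ a=b$. For a functor $G:\mathtt D\to\mathtt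 C$ between model categories, a K right derived functor of $G$ is a functor $\mathrm{Ho}(\mathtt D)\to\mathrm{Ho}(\mathtt C)$ that is, together with some natural transformation, a left Kan extension of $\gamma_{\mathtt C}\circ G$ along $\gamma_{\mathtt D}$; an S right derived functor of $G$ is a functor that is naturally isomorphic to the unique factorization, on the nose, of $\gamma_{\mathtt C}\circ G\circ R$ through $\gamma_{\mathtt D}$, for some fibrant C-replacement functor $R$ of $\mathtt D$ for which $\gamma_{\mathtt C}\circ G\circ R$ inverts weak equivalences. \textbf{Theorem.} Let $\mathtt S$ be a small category, let $\mathtt M$ be a model category, and let $\sigma$ be a model structure on $\mathrm{Fun}(\mathtt S,\mathtt M)$ for which the adjunction $(-)^*\dashv\mathrm{Lim}$ between the constant diagram functor $\mathtt M\to\mathrm{Fun}(\mathtt S,\mathtt M)$ and the limit functor is a Quillen adjunction. Then: (i) A K right derived functor and an S right derived functor of $\mathrm{Lim}$ with respect to $\sigma$ exist, and for every fibrant C-replacement functor $R_\sigma$ the functor $\gamma_{\mathtt M}\circ\mathrm{Lim}\circ R_\sigma$ inverts the weak equivalences of $\sigma$. Denote by $\mathbb R_\sigma\mathrm{Lim}$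 any K or S right derived functor of $\mathrm{Lim}$. Let $X\in\mathrm{Fun}(\mathtt S,\mathtt M)$. (ii) As an object of $\mathtt M$, the homotopy limit $\mathbb R_\sigma\mathrm{Lim}(X)$ is determined up to a zigzag of weak equivalences: any two such derived functors (K or S) have values at $X$ related by $\approx$. Moreover $$\mathbb R_\sigma\mathrm{Lim}(X)\approx\mathrm{Lim}(R_\sigma X)$$ for every such derived functor and every fibrant C-replacement functor $R_\sigma$. (iii) For every fibrant C-replacement $\tilde F_\sigma X$ and every fibrant replacement $F_\sigma X$ of $X$ in $\sigma$, there are liftings $\ell_\sigma:\tilde F_\sigma X\to F_\sigma X$; for each of them $$\mathrm{Lim}(\ell_\sigma):\mathrm{Lim}(\tilde F_\sigma X)\to\mathrm{Lim}(F_\sigma X)$$ is a weak equivalence of $\mathtt M$, and $\gamma_{\mathtt M}(\mathrm{Lim}(\ell_\sigma))$ does not depend on the chosen lifting. (iv) The same holds for liftings $R_\sigma X\to\tilde F_\sigma X$ and for liftings $\tilde F_\sigma X\to R_\sigma X$, so that there are weak equivalences $\mathrm{Lim}(R_\sigma X)\to\mathrm{Lim}(\tilde F_\sigma X)$ and $\mathrm{Lim}(\tilde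 F_\sigma X)\to\mathrm{Lim}(R_\sigma X)$ whose images in $\mathrm{Ho}(\mathtt M)$ do not depend on the choice of the liftings. -/

import Mathlib

open CategoryTheory Limits HomotopicalAlgebra

universe v u v' u'

namespace HoLim

/-- A model category with all small limits and colimits and with functorial factorizations
(two-out-of-three, retracts and liftings are axioms of `ModelCategory`). -/
class CompleteModelCategory (C : Type u) [Category.{v} C] extends ModelCategory C where
  hasLimits : HasLimits C
  hasColimits : HasColimits C
  functorial_cof_trivFib :
    MorphismProperty.HasFunctorialFactorization (cofibrations C) (trivialFibrations C)
  functorial_trivCof_fib :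
    MorphismProperty.HasFunctorialFactorization (trivialCofibrations C) (fibrations C)

attribute [instance] CompleteModelCategory.hasLimits CompleteModelCategory.hasColimits
  CompleteModelCategory.functorial_cof_trivFib CompleteModelCategory.functorial_trivCof_fib

/-- The homotopy category: the strict localization at the weak equivalences.
Its objects are (wrapped) objects of `C`. -/
abbrev Ho (C : Type u) [Category.{v} C] [CategoryWithWeakEquivalences C] :=
  (weakEquivalences C).Localization

/-- The localization functor `C ⥤ Ho C`. -/
abbrev gamma (C : Type u) [Category.{v} C] [CategoryWithWeakEquivalences C] : C ⥤ Ho C :=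
  (weakEquivalences C).Q

/-- The object of `C` that an object of `Ho C` is. -/
def Ho.toObj {C : Type u} [Category.{v} C] [CategoryWithWeakEquivalences C] (Y : Ho C) : C :=
  (Localization.Construction.objEquiv (weakEquivalences C)).symm Y

theorem gamma_obj_toObj {C : Type u} [Category.{v} C] [CategoryWithWeakEquivalences C]
    (Y : Ho C) : (gamma C).obj (Ho.toObj Y) = Y :=
  (Localization.Construction.objEquiv (weakEquivalences C)).apply_symm_apply Y

/-- `A ≈ B`: the objects are related by a finite zigzag of weak equivalences. -/
def WeqZigzag {C : Type u} [Category.{v} C] [CategoryWithWeakEquivalences C] (A B : C) : Prop :=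
  Relation.EqvGen (fun A B : C => ∃ f : A ⟶ B, WeakEquivalence f) A B

/-- An adjunction `F ⊣ G` between model categories is a Quillen adjunction if `F` preserves
cofibrations and trivial cofibrations. -/
structure IsQuillenAdjunction {C : Type u} [Category.{v} C] [ModelCategory C]
    {D : Type u'} [Category.{v'} D] [ModelCategory D] {F : C ⥤ D} {G : D ⥤ C}
    (_adj : F ⊣ G) : Prop where
  cofibration : ∀ {A B : C} (i : A ⟶ B), Cofibration i → Cofibration (F.map i)
  trivialCofibration : ∀ {A B : C} (i : A ⟶ B), Cofibration i → WeakEquivalence i →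
    Cofibration (F.map i) ∧ WeakEquivalence (F.map i)

section Replacements

variable {C : Type u} [Category.{v} C] [ModelCategory C]

/-- A (local) fibrant replacement of `X`: a weak equivalence from `X` to a fibrant object. -/
structure FibrantReplacement (X : C) where
  obj : C
  map : X ⟶ obj
  weakEquivalence : WeakEquivalence map
  isFibrant : IsFibrant obj

/-- A local fibrant C-replacement of `X`: a trivial cofibration from `X` to a fibrant object.
The normalization that the map be the identity of `X` when `X` is fibrant is not required, so
the normalized replacements are special cases. -/
structure FibrantCReplacement (X : C) extends FibrantReplacement X where
  cofibration : Cofibration map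

/-- The normalized choice for a fibrant object. -/
def FibrantCReplacement.refl (X : C) (hX : IsFibrant X) : FibrantCReplacement X where
  obj := X
  map := 𝟙 X
  weakEquivalence := inferInstance
  isFibrant := hX
  cofibration := inferInstance

variable (C) in
/-- A fibrant C-replacement functor: an endofunctor `R` with a natural transformation
`r : 𝟭 ⟶ R` all of whose components are trivial cofibrations to fibrant objects. -/
structure FibrantCReplacementFunctor where
  functor : C ⥤ C
  map : 𝟭 C ⟶ functor
  weakEquivalence : ∀ X, WeakEquivalence (map.app X)
  cofibration : ∀ X, Cofibration (map.app X)
  isFibrant : ∀ X, IsFibrant (functor.obj X)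

/-- The value at `X` of a fibrant C-replacement functor. -/
def FibrantCReplacementFunctor.at (R : FibrantCReplacementFunctor C) (X : C) :
    FibrantCReplacement X where
  obj := R.functor.obj X
  map := R.map.app X
  weakEquivalence := R.weakEquivalence X
  isFibrant := R.isFibrant X
  cofibration := R.cofibration X

/-- A functorial factorization into a trivial cofibration and a fibration gives a fibrant
C-replacement functor, by factoring the maps `X ⟶ ⊤_ C`. -/
noncomputable def FibrantCReplacementFunctor.ofFactorization
    (φ : MorphismProperty.FunctorialFactorizationData (trivialCofibrations C) (fibrations C)) :
    FibrantCReplacementFunctor C where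
  functor :=
    { obj := fun X => φ.Z.obj (Arrow.mk (terminal.from X))
      map := fun f => φ.Z.map (Arrow.homMk f (𝟙 _) (terminal.hom_ext (P := _) _ _))
      map_id := fun X => by
        rw [← φ.Z.map_id]; rfl
      map_comp := fun f g => by
        rw [← φ.Z.map_comp]; congr 1; ext <;> simp }
  map :=
    { app := fun X => φ.i.app (Arrow.mk (terminal.from X))
      naturality := fun X Y f =>
        φ.i.naturality (Arrow.homMk f (𝟙 _) (terminal.hom_ext (P := _) _ _) :
          Arrow.mk (terminal.from X) ⟶ Arrow.mk (terminal.from Y)) }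
  weakEquivalence := fun X =>
    ((mem_trivialCofibrations_iff _).1 (φ.hi (Arrow.mk (terminal.from X)))).2
  cofibration := fun X =>
    ((mem_trivialCofibrations_iff _).1 (φ.hi (Arrow.mk (terminal.from X)))).1
  isFibrant := fun X => by
    rw [isFibrant_iff_of_isTerminal (φ.p.app (Arrow.mk (terminal.from X))) terminalIsTerminal,
      fibration_iff]
    exact φ.hp _

end Replacements

section DerivedFunctors

variable {C : Type u} [Category.{v} C] [ModelCategory C]
  {D : Type u'} [Category.{v'} D] [ModelCategory D]

/-- `H` is a K (Kan extension) right derived functor of `G`: it is a left Kan extension of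
`G ⋙ gamma` along the localization functor of the source. -/
def IsKRightDerivedFunctor (G : D ⥤ C) (H : Ho D ⥤ Ho C) : Prop :=
  ∃ α : G ⋙ gamma C ⟶ gamma D ⋙ H, H.IsRightDerivedFunctor α (weakEquivalences D)

/-- `H` is an S (strongly universal) right derived functor of `G`: it is isomorphic to the unique
on the nose factorization through `Ho D` of `R ⋙ G ⋙ gamma`, for a fibrant C-replacement
functor `R`. -/
def IsSRightDerivedFunctor (G : D ⥤ C) (H : Ho D ⥤ Ho C) : Prop :=
  ∃ (R : FibrantCReplacementFunctor D)
    (hR : (weakEquivalences D).IsInvertedBy (R.functor ⋙ G ⋙ gamma C)),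
    Nonempty (Localization.Construction.lift (R.functor ⋙ G ⋙ gamma C) hR ≅ H)

/-- For fibrant replacements `A`, `B` of `X`: there are liftings `ℓ : A ⟶ B` under `X`, `G`
sends each of them to a weak equivalence, and the image in `Ho C` of the latter does not depend
on `ℓ`. -/
structure InducesWeakEquivalence (G : D ⥤ C) {X : D} (A B : FibrantReplacement X) : Prop where
  exists_lifting : ∃ l : A.obj ⟶ B.obj, A.map ≫ l = B.map
  weakEquivalence : ∀ l : A.obj ⟶ B.obj, A.map ≫ l = B.map → WeakEquivalence (G.map l)
  independent : ∀ l l' : A.obj ⟶ B.obj, A.map ≫ l = B.map → A.map ≫ l' = B.map →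
    (gamma C).map (G.map l) = (gamma C).map (G.map l')

end DerivedFunctors

section HomotopyLimits

variable (S : Type v) [SmallCategory S] (M : Type u) [Category.{v} M]
  [CompleteModelCategory M] [CompleteModelCategory (S ⥤ M)]

/-- `H` is a (K or S) homotopy limit functor for the given model structure on diagrams. -/
def IsHomotopyLimitFunctor (H : Ho (S ⥤ M) ⥤ Ho M) : Prop :=
  IsKRightDerivedFunctor (lim : (S ⥤ M) ⥤ M) H ∨ IsSRightDerivedFunctor (lim : (S ⥤ M) ⥤ M) H

end HomotopyLimits

/-- The value at the object `X` of a functor between homotopy categories, as an object of the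
target model category. -/
def value {C : Type u} [Category.{v} C] [CategoryWithWeakEquivalences C]
    {D : Type u'} [Category.{v'} D] [CategoryWithWeakEquivalences D]
    (H : Ho D ⥤ Ho C) (X : D) : C :=
  Ho.toObj (H.obj ((gamma D).obj X))

end HoLim

/-! Only the Quillen adjunction matters, so everything is proved for a right Quillen functor `G : D
⥤ C`. By Ken Brown's lemma (`IsQuillenAdjunction.weakEquivalence`) `G` preserves weak equivalences
between fibrant objects. Hence `R.functor ⋙ G ⋙ gamma C` inverts weak equivalences, and its
factorization through `Ho D` is a Kan extension, because its comparison map is invertible on fibrant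
objects. Thus every S derived functor is a K derived functor, and all of them are isomorphic by
uniqueness of Kan extensions.

An isomorphism in `Ho C` gives a zigzag in `C` (`WeqZigzag.of_iso`): pass to bifibrant objects,
where the isomorphism is the image of an actual map, and that map is a weak equivalence.

Liftings exist because a trivial cofibration lifts against a map from a fibrant object to the
terminal one. They are weak equivalences by two-out-of-three, and `G` of them agree in `Ho C` by a
path object argument (`IsQuillenAdjunction.map_eq`). -/

namespace HoLim

/-! ### Isomorphisms in the homotopy category and zigzags of weak equivalences -/

section HomotopyCategory

variable {C : Type u} [Category.{v} C] [ModelCategory C]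

/-- Between bifibrant objects, a fibration which becomes an isomorphism in a localization with
respect to weak equivalences is a weak equivalence. -/
theorem weakEquivalence_of_fibration_of_isIso_map {H : Type*} [Category* H] (L : C ⥤ H)
    [L.IsLocalization (weakEquivalences C)] {Z Y : C} [IsCofibrant Z] [IsFibrant Z]
    [IsCofibrant Y] [IsFibrant Y] (p : Z ⟶ Y) [Fibration p] [IsIso (L.map p)] :
    WeakEquivalence p := by
  obtain ⟨g, hg⟩ := map_surjective_of_isLocalization L Y Z (inv (L.map p))
  obtain ⟨P, _, ⟨h⟩⟩ := ((LeftHomotopyRel.iff_map_eq L Y Y (f := g ≫ p) (g := 𝟙 Y)).2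
    (by simp [hg])).exists_good_cylinder
  -- `g` is only a homotopy section of `p`; lifting the homotopy along the fibration `p` deforms it
  -- to a strict section `s`.
  obtain ⟨s, h', hs⟩ := h.covering_homotopy p g rfl
  have hsp : s ≫ p = 𝟙 Y := by rw [← h'.h₁, Category.assoc, hs, h.h₁]
  obtain ⟨Q, ⟨k⟩⟩ := (LeftHomotopyRel.iff_map_eq L Z Z (f := p ≫ s) (g := 𝟙 Z)).2 (by
    have : L.map g = L.map s := (LeftHomotopyRel.iff_map_eq L Y Z).1 h'.leftHomotopyRel
    rw [L.map_comp, ← this, hg, IsIso.hom_inv_id, L.map_id])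
  have hps : WeakEquivalence (p ≫ s) := k.weakEquivalence_iff.2 inferInstance
  rw [weakEquivalence_iff] at hps ⊢
  -- Since `s ≫ p = 𝟙 Y`, the map `p` is a retract of `p ≫ s`, which is homotopic to the identity.
  exact MorphismProperty.of_retract
    { i := Arrow.homMk (𝟙 Z) s
      r := Arrow.homMk (𝟙 Z) p (by simp [hsp])
      retract := by ext <;> simp [hsp] } hps

/-- A morphism between bifibrant objects which becomes an isomorphism in a localization with
respect to weak equivalences is a weak equivalence. -/
theorem weakEquivalence_of_isIso_map {H : Type*} [Category* H] (L : C ⥤ H)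
    [L.IsLocalization (weakEquivalences C)] {X Y : C} [IsCofibrant X] [IsFibrant X]
    [IsCofibrant Y] [IsFibrant Y] (f : X ⟶ Y) [IsIso (L.map f)] :
    WeakEquivalence f := by
  have h := MorphismProperty.factorizationData (trivialCofibrations C) (fibrations C) f
  have : IsCofibrant h.Z := isCofibrant_of_cofibration h.i
  have : IsFibrant h.Z := isFibrant_of_fibration h.p
  have : IsIso (L.map h.i) := Localization.inverts L (weakEquivalences C) _ (mem_weakEquivalences _)
  have : IsIso (L.map h.p) := by
    have : IsIso (L.map h.i ≫ L.map h.p) := by rw [← L.map_comp, h.fac]; infer_instance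
    exact IsIso.of_isIso_comp_left (L.map h.i) _
  have := weakEquivalence_of_fibration_of_isIso_map L h.p
  rw [← h.fac]
  infer_instance

theorem WeqZigzag.of_weakEquivalence {A B : C} (f : A ⟶ B) [hf : WeakEquivalence f] :
    WeqZigzag A B :=
  .rel _ _ ⟨f, hf⟩

theorem WeqZigzag.nonempty_iso {A B : C} (h : WeqZigzag A B) :
    Nonempty ((gamma C).obj A ≅ (gamma C).obj B) := by
  induction h with
  | rel _ _ h =>
    obtain ⟨f, _⟩ := h
    exact ⟨Localization.isoOfHom _ (weakEquivalences C) f (mem_weakEquivalences f)⟩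
  | refl => exact ⟨Iso.refl _⟩
  | symm _ _ _ h => exact ⟨h.some.symm⟩
  | trans _ _ _ _ _ h h' => exact ⟨h.some ≪≫ h'.some⟩

theorem exists_bifibrant_weqZigzag (A : C) :
    ∃ B : C, IsCofibrant B ∧ IsFibrant B ∧ WeqZigzag A B := by
  obtain ⟨A', _, p, _, _⟩ := CofibrantObject.HoCat.exists_resolution A
  obtain ⟨B, _, i, _, _⟩ := FibrantObject.HoCat.exists_resolution A'
  exact ⟨B, isCofibrant_of_cofibration i, inferInstance,
    .trans _ _ _ (.symm _ _ (WeqZigzag.of_weakEquivalence p)) (WeqZigzag.of_weakEquivalence i)⟩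

/-- Objects which are isomorphic in the homotopy category are related by a zigzag of weak
equivalences. -/
theorem WeqZigzag.of_iso {A B : C} (e : (gamma C).obj A ≅ (gamma C).obj B) : WeqZigzag A B := by
  obtain ⟨A', _, _, hA⟩ := exists_bifibrant_weqZigzag A
  obtain ⟨B', _, _, hB⟩ := exists_bifibrant_weqZigzag B
  let e' := hA.nonempty_iso.some.symm ≪≫ e ≪≫ hB.nonempty_iso.some
  obtain ⟨f, hf⟩ := map_surjective_of_isLocalization (gamma C) A' B' e'.hom
  have : IsIso ((gamma C).map f) := by rw [hf]; infer_instance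
  have := weakEquivalence_of_isIso_map (gamma C) f
  exact .trans _ _ _ hA (.trans _ _ _ (WeqZigzag.of_weakEquivalence f) (.symm _ _ hB))

theorem WeqZigzag.of_toObj_iso {Y Z : Ho C} (e : Y ≅ Z) :
    WeqZigzag (Ho.toObj Y) (Ho.toObj Z) :=
  .of_iso (eqToIso (gamma_obj_toObj Y) ≪≫ e ≪≫ eqToIso (gamma_obj_toObj Z).symm)

end HomotopyCategory

/-! ### Right Quillen functors and their derived functors -/

section QuillenAdjunction

variable {C : Type u} [Category.{v} C] [ModelCategory C]
  {D : Type u'} [Category.{v'} D] [ModelCategory D] {F : C ⥤ D} {G : D ⥤ C} {adj : F ⊣ G}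

theorem IsQuillenAdjunction.fibration (h : IsQuillenAdjunction adj) {X Y : D} (p : X ⟶ Y)
    [Fibration p] : Fibration (G.map p) := by
  rw [fibration_iff, ← trivialCofibrations_rlp]
  intro A B i hi
  obtain ⟨_, _⟩ := (mem_trivialCofibrations_iff i).1 hi
  obtain ⟨_, _⟩ := h.trivialCofibration i inferInstance inferInstance
  rw [← adj.hasLiftingProperty_iff]
  infer_instance

theorem IsQuillenAdjunction.weakEquivalence_of_fibration (h : IsQuillenAdjunction adj) {X Y : D}
    (p : X ⟶ Y) [Fibration p] [WeakEquivalence p] : WeakEquivalence (G.map p) := by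
  suffices trivialFibrations C (G.map p) from ((mem_trivialFibrations_iff _).1 this).2
  rw [← cofibrations_rlp]
  intro A B i hi
  have := h.cofibration i ((cofibration_iff i).2 hi)
  rw [← adj.hasLiftingProperty_iff]
  infer_instance

/-- A right Quillen functor preserves weak equivalences between fibrant objects. -/
theorem IsQuillenAdjunction.weakEquivalence (h : IsQuillenAdjunction adj) {X Y : D} (w : X ⟶ Y)
    [IsFibrant X] [IsFibrant Y] [WeakEquivalence w] : WeakEquivalence (G.map w) := by
  let b : FibrantBrownFactorization w := Classical.arbitrary _
  have := h.weakEquivalence_of_fibration b.p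
  have := h.weakEquivalence_of_fibration b.r
  have : WeakEquivalence (G.map b.i) :=
    weakEquivalence_of_postcomp_of_fac (g := G.map b.r) (fg := 𝟙 _)
      (by rw [← G.map_comp, b.i_r, G.map_id])
  rw [← b.fac, G.map_comp]
  infer_instance

/-- The hypothesis of the recognition criterion for derived functors: a functor under `G ⋙ gamma C`
is derived as soon as its comparison map is invertible on fibrant objects. -/
theorem IsQuillenAdjunction.derives (h : IsQuillenAdjunction adj) :
    (FibrantObject.localizerMorphism D).Derives (G ⋙ gamma C) := by
  intro X Y f hf
  have : WeakEquivalence f.hom := (weakEquivalence_iff _).2 hf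
  have : IsFibrant X.obj := X.property
  have : IsFibrant Y.obj := Y.property
  have := h.weakEquivalence f.hom
  exact Localization.inverts (gamma C) (weakEquivalences C) _ (mem_weakEquivalences (G.map f.hom))

theorem IsQuillenAdjunction.isInvertedBy (h : IsQuillenAdjunction adj)
    (R : FibrantCReplacementFunctor D) :
    (weakEquivalences D).IsInvertedBy (R.functor ⋙ G ⋙ gamma C) := by
  intro X Y f hf
  have := (weakEquivalence_iff _).2 hf
  have := R.weakEquivalence X
  have := R.weakEquivalence Y
  have := R.isFibrant X
  have := R.isFibrant Y
  -- By naturality this composite is `f` followed by the replacement of `Y`, so two-out-of-three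
  -- applies to `R.functor.map f`.
  have : WeakEquivalence (R.map.app X ≫ R.functor.map f) := by
    rw [← R.map.naturality]
    dsimp
    infer_instance
  have := weakEquivalence_of_precomp (R.map.app X) (R.functor.map f)
  have := h.weakEquivalence (R.functor.map f)
  exact Localization.inverts (gamma C) (weakEquivalences C) _ (mem_weakEquivalences _)

/-- An S right derived functor of a right Quillen functor is a K right derived functor. -/
theorem IsQuillenAdjunction.isKRightDerivedFunctor_lift (h : IsQuillenAdjunction adj)
    (R : FibrantCReplacementFunctor D) :
    IsKRightDerivedFunctor G
      (Localization.Construction.lift (R.functor ⋙ G ⋙ gamma C) (h.isInvertedBy R)) := by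
  refine ⟨Functor.whiskerRight R.map (G ⋙ gamma C) ≫
    eqToHom (Localization.Construction.fac _ (h.isInvertedBy R)).symm,
    h.derives.isRightDerivedFunctor_of_isIso _ fun X => ?_⟩
  have : IsFibrant X.obj := X.property
  have := R.isFibrant X.obj
  have := R.weakEquivalence X.obj
  have : WeakEquivalence (G.map (R.map.app X.obj)) :=
    h.weakEquivalence (X := X.obj) (Y := R.functor.obj X.obj) (R.map.app X.obj)
  have : IsIso ((gamma C).map (G.map (R.map.app X.obj))) :=
    Localization.inverts (gamma C) (weakEquivalences C) _ (mem_weakEquivalences _)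
  rw [NatTrans.comp_app]
  exact IsIso.comp_isIso' this inferInstance

theorem IsKRightDerivedFunctor.of_iso {G : D ⥤ C} {H H' : Ho D ⥤ Ho C}
    (hH : IsKRightDerivedFunctor G H) (e : H ≅ H') : IsKRightDerivedFunctor G H' := by
  obtain ⟨α, hα⟩ := hH
  exact ⟨_, (Functor.isRightDerivedFunctor_iff_of_iso α _ _ e rfl).1 hα⟩

theorem IsQuillenAdjunction.isKRightDerivedFunctor (h : IsQuillenAdjunction adj)
    {H : Ho D ⥤ Ho C} (hH : IsSRightDerivedFunctor G H) : IsKRightDerivedFunctor G H := by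
  obtain ⟨R, _, ⟨e⟩⟩ := hH
  exact (h.isKRightDerivedFunctor_lift R).of_iso e

theorem IsKRightDerivedFunctor.nonempty_iso {G : D ⥤ C} {H H' : Ho D ⥤ Ho C}
    (hH : IsKRightDerivedFunctor G H) (hH' : IsKRightDerivedFunctor G H') :
    Nonempty (H ≅ H') := by
  obtain ⟨α, _⟩ := hH
  obtain ⟨β, _⟩ := hH'
  exact ⟨Functor.rightDerivedUnique H H' α β (weakEquivalences D)⟩

theorem IsKRightDerivedFunctor.weqZigzag_value {G : D ⥤ C} {H H' : Ho D ⥤ Ho C}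
    (hH : IsKRightDerivedFunctor G H) (hH' : IsKRightDerivedFunctor G H') (X : D) :
    WeqZigzag (value H X) (value H' X) :=
  .of_toObj_iso ((hH.nonempty_iso hH').some.app _)

theorem IsQuillenAdjunction.weqZigzag_value (h : IsQuillenAdjunction adj) {H : Ho D ⥤ Ho C}
    (hH : IsKRightDerivedFunctor G H) (R : FibrantCReplacementFunctor D) (X : D) :
    WeqZigzag (value H X) (G.obj (R.functor.obj X)) :=
  .of_iso (eqToIso (gamma_obj_toObj _) ≪≫
    (hH.nonempty_iso (h.isKRightDerivedFunctor_lift R)).some.app _ ≪≫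
    (eqToIso (Localization.Construction.fac _ (h.isInvertedBy R))).app X)

/-- A right Quillen functor identifies, in the homotopy category, two morphisms between fibrant
objects which agree after precomposition with a trivial cofibration. -/
theorem IsQuillenAdjunction.map_eq (h : IsQuillenAdjunction adj) {X A B : D} [IsFibrant B]
    (i : X ⟶ A) [Cofibration i] [WeakEquivalence i] {l l' : A ⟶ B} (hl : i ≫ l = i ≫ l') :
    (gamma C).map (G.map l) = (gamma C).map (G.map l') := by
  obtain ⟨P, _⟩ := PathObject.exists_very_good B
  -- A lift is a right homotopy from `l` to `l'`, constant after restriction along `i`.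
  have sq : CommSq (i ≫ l ≫ P.ι) i P.p (prod.lift l l') :=
    ⟨Limits.prod.hom_ext
      (by rw [Category.assoc, Category.assoc, P.p_fst, Category.assoc, Category.assoc, P.ι_p₀,
        Category.comp_id, prod.lift_fst])
      (by rw [Category.assoc, Category.assoc, P.p_snd, Category.assoc, Category.assoc, P.ι_p₁,
        Category.comp_id, prod.lift_snd, hl])⟩
  have h₀ : sq.lift ≫ P.p₀ = l := by
    rw [← P.p_fst, sq.fac_right_assoc, prod.lift_fst]
  have h₁ : sq.lift ≫ P.p₁ = l' := by
    rw [← P.p_snd, sq.fac_right_assoc, prod.lift_snd]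
  have := h.weakEquivalence P.ι
  have : IsIso ((gamma C).map (G.map P.ι)) :=
    Localization.inverts (gamma C) (weakEquivalences C) _ (mem_weakEquivalences _)
  -- Both projections are retractions of `P.ι`, whose image in `Ho C` is invertible since `P.ι` is a
  -- weak equivalence of fibrant objects.
  have hP : (gamma C).map (G.map P.p₀) = (gamma C).map (G.map P.p₁) := by
    simp only [← cancel_epi ((gamma C).map (G.map P.ι)), ← Functor.map_comp, P.ι_p₀, P.ι_p₁]
  calc
    _ = (gamma C).map (G.map (sq.lift ≫ P.p₀)) := by rw [h₀]
    _ = (gamma C).map (G.map (sq.lift ≫ P.p₁)) := by simp only [Functor.map_comp, hP]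
    _ = _ := by rw [h₁]

theorem IsQuillenAdjunction.inducesWeakEquivalence (h : IsQuillenAdjunction adj) {X : D}
    (A : FibrantCReplacement X) (B : FibrantReplacement X) :
    InducesWeakEquivalence G A.toFibrantReplacement B := by
  have := A.isFibrant
  have := B.isFibrant
  have := A.weakEquivalence
  have := B.weakEquivalence
  have := A.cofibration
  refine ⟨?_, fun l hl => ?_, fun l l' hl hl' => h.map_eq A.map (hl.trans hl'.symm)⟩
  · have sq : CommSq B.map A.map (terminal.from _) (terminal.from _) := ⟨by simp⟩
    exact ⟨sq.lift, sq.fac_left⟩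
  · have : WeakEquivalence l := weakEquivalence_of_precomp_of_fac hl
    exact h.weakEquivalence l

end QuillenAdjunction

theorem IsHomotopyLimitFunctor.isKRightDerivedFunctor {S : Type v} [SmallCategory S]
    {M : Type u} [Category.{v} M] [CompleteModelCategory M] [CompleteModelCategory (S ⥤ M)]
    (hQ : IsQuillenAdjunction
      (constLimAdj : (Functor.const S : M ⥤ S ⥤ M) ⊣ (lim : (S ⥤ M) ⥤ M)))
    {H : Ho (S ⥤ M) ⥤ Ho M} (hH : IsHomotopyLimitFunctor S M H) :
    IsKRightDerivedFunctor (lim : (S ⥤ M) ⥤ M) H :=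
  hH.elim id hQ.isKRightDerivedFunctor

end HoLim

theorem mainTheorem2 {S : Type v} [SmallCategory S] {M : Type u} [Category.{v} M]
    [HoLim.CompleteModelCategory M] [HoLim.CompleteModelCategory (S ⥤ M)]
    (hQ : HoLim.IsQuillenAdjunction
      (constLimAdj : (Functor.const S : M ⥤ S ⥤ M) ⊣ (lim : (S ⥤ M) ⥤ M))) :
    -- the K and the S homotopy limit functors exist, the latter for every choice of `R`
    (∃ H : HoLim.Ho (S ⥤ M) ⥤ HoLim.Ho M, HoLim.IsKRightDerivedFunctor lim H) ∧
    (∃ H : HoLim.Ho (S ⥤ M) ⥤ HoLim.Ho M, HoLim.IsSRightDerivedFunctor lim H) ∧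
    (∀ R : HoLim.FibrantCReplacementFunctor (S ⥤ M),
      (weakEquivalences (S ⥤ M)).IsInvertedBy (R.functor ⋙ lim ⋙ HoLim.gamma M)) ∧
    ∀ X : S ⥤ M,
      -- the homotopy limit is determined up to a zigzag of weak equivalences
      (∀ H H' : HoLim.Ho (S ⥤ M) ⥤ HoLim.Ho M,
        HoLim.IsHomotopyLimitFunctor S M H → HoLim.IsHomotopyLimitFunctor S M H' →
          HoLim.WeqZigzag (HoLim.value H X) (HoLim.value H' X)) ∧
      -- it is represented by `Lim (R X)`
      (∀ (H : HoLim.Ho (S ⥤ M) ⥤ HoLim.Ho M) (R : HoLim.FibrantCReplacementFunctor (S ⥤ M)),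
        HoLim.IsHomotopyLimitFunctor S M H →
          HoLim.WeqZigzag (HoLim.value H X) (lim.obj (R.functor.obj X))) ∧
      -- weak equivalences in both directions between global and local C-replacements
      (∀ (R : HoLim.FibrantCReplacementFunctor (S ⥤ M)) (F' : HoLim.FibrantCReplacement X),
        HoLim.InducesWeakEquivalence (lim : (S ⥤ M) ⥤ M)
          (R.at X).toFibrantReplacement F'.toFibrantReplacement ∧
        HoLim.InducesWeakEquivalence (lim : (S ⥤ M) ⥤ M)
          F'.toFibrantReplacement (R.at X).toFibrantReplacement) ∧
      -- weak equivalences from local C-replacements to local replacements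
      (∀ (F' : HoLim.FibrantCReplacement X) (F : HoLim.FibrantReplacement X),
        HoLim.InducesWeakEquivalence (lim : (S ⥤ M) ⥤ M) F'.toFibrantReplacement F) := by
  let R := HoLim.FibrantCReplacementFunctor.ofFactorization
    (MorphismProperty.functorialFactorizationData (trivialCofibrations (S ⥤ M))
      (fibrations (S ⥤ M)))
  exact ⟨⟨_, hQ.isKRightDerivedFunctor_lift R⟩, ⟨_, R, hQ.isInvertedBy R, ⟨Iso.refl _⟩⟩,
    hQ.isInvertedBy, fun X =>
      ⟨fun _ _ hH hH' => HoLim.IsKRightDerivedFunctor.weqZigzag_value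
          (hH.isKRightDerivedFunctor hQ) (hH'.isKRightDerivedFunctor hQ) X,
        fun _ R hH => hQ.weqZigzag_value (hH.isKRightDerivedFunctor hQ) R X,
        fun R F' => ⟨hQ.inducesWeakEquivalence (R.at X) _, hQ.inducesWeakEquivalence F' _⟩,
        fun F' F => hQ.inducesWeakEquivalence F' F⟩⟩
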